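/- Let $f:\mathbb{R}^d\to[0,\infty)$ be a bounded probability density function, let $x_1,x_2,\dots$ be independent random points of $\mathbb{R}^d$ with common density $f$, let $\mathcal{X}_n=\{x_1,\dots,x_n\}$ (the binomial process), and for each $n$ let $\mathcal{P}_n$ be a Poisson point process on $\mathbb{R}^d$ with intensity function $x\mapsto n f(x)$; that is, $\mathcal{P}_n$ is a random set for which $|\mathcal{P}_n\cap A|$ is Poisson distributed with parameter $\int_A n f(x)\,dx$ for every Borel set $A$, and the numbers of points of $\mathcal{P}_n$ in disjoint Borel sets $A_1,\dots,A_m$ are mutually independent. A family of functions $g_{r,p}$ ($r>0$, $p\in\mathbb{N}$) from the power set of $\mathbb{R}^d$ to $\{0,1\}$ is called a finite geometric property if, for all $r>0$, $p\in\mathbb{N}$ and $Y\subseteq\mathbb{R}^d$: (i) $g_{r,p}(Y)=g_{r,p}(Y+t)$ for all $t\in\mathbb{R}^d$; (ii) $g_{r,p}(Y)=g_{\lambda r,p}(\lambda Y)$ for all $\lambda>0$; (iii) $g_{r,p}(Y)=0$ whenever $|Y|\neq p$; (iv) $g_{r,p}(Y)=1$ implies $\operatorname{diam}Y\le C\,r\,p$,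 for some constant $C$ that does not depend on $r$, $p$ and $Y$. For a finite set $P\subset\mathbb{R}^d$ put $\mathrm{Count}(g_{r,p},P)=\sum_{Y\subseteq P}g_{r,p}(Y)$ (recall that $\mathcal{P}_n$ is almost surely finite). Let $g_{r,p}$ be a finite geometric property and fix $p\ge 2$, such that $(y_1,\dots,y_p)\mapsto g_{r,p}(\{y_1,\dots,y_p\})$ is Borel measurable for every $r>0$ and such that $g_{r,p}(\mathcal{X}_p)=1$ has positive probability for all sufficiently small $r>0$. Let $(r_n)$ be a sequence of positive reals with $\lim_{n\to\infty}r_n=0$. Then $\mathrm{Count}(g_{r_n,p},\mathcal{X}_n)$ and $\mathrm{Count}(g_{r_n,p},\mathcal{P}_n)$ are integrable for every $n$, and $$\lim_{n\to\infty}\frac{E(\mathrm{Count}(g_{r_n,p},\mathcal{X}_n))}{n\,(r_n^d n)^{p-1}}=\lim_{n\to\infty}\frac{E(\mathrm{Count}(g_{r_n,p},\mathcal{P}_n))}{n\,(r_n^d n)^{p-1}}=\mu_{g_{1,p}},$$ where $$\mu_{g_{1,p}}:=\frac{1}{p!}\int_{\mathbb{R}^d}f(x)^p\,dx\ \int_{(\mathbb{R}^d)^{p-1}}g_{1,p}(\{0,x_1,\dots,x_{p-1}\})\,d(x_1,\dots,x_{p-1}),$$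 both integrals being those of integrable functions. -/

import Mathlib

open MeasureTheory ProbabilityTheory Filter Topology

noncomputable section

/-- A family `g r p` (`r > 0`, `p ∈ ℕ`) of functions on the power set of `ℝ^d` is a finite
geometric property: it is `{0,1}`-valued, translation invariant, scaling equivariant (for `l > 0`,
so that the index `l * r` is again a positive radius), supported on `p`-element sets, and local.
The values of `g` at `r ≤ 0` are irrelevant. -/
structure IsFiniteGeometricProperty {d : ℕ}
    (g : ℝ → ℕ → Set (EuclideanSpace ℝ (Fin d)) → ℝ) : Prop where
  indicator : ∀ (r : ℝ) (p : ℕ) (Y : Set (EuclideanSpace ℝ (Fin d))), 0 < r →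
    g r p Y = 0 ∨ g r p Y = 1
  translation : ∀ (r : ℝ) (p : ℕ) (Y : Set (EuclideanSpace ℝ (Fin d)))
    (t : EuclideanSpace ℝ (Fin d)), 0 < r → g r p Y = g r p ((fun y => y + t) '' Y)
  scaling : ∀ (r : ℝ) (p : ℕ) (Y : Set (EuclideanSpace ℝ (Fin d))) (l : ℝ), 0 < r → 0 < l →
    g r p Y = g (l * r) p ((fun y => l • y) '' Y)
  finite : ∀ (r : ℝ) (p : ℕ) (Y : Set (EuclideanSpace ℝ (Fin d))), 0 < r →
    Y.encard ≠ (p : ℕ∞) → g r p Y = 0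
  isLocal : ∃ C : ℝ, ∀ (r : ℝ) (p : ℕ) (Y : Set (EuclideanSpace ℝ (Fin d))), 0 < r →
    g r p Y = 1 → Metric.diam Y ≤ C * r * p

/-- The number of occurrences `∑_{Y ⊆ P} φ(Y)` of the property with indicator function `φ` in a
finite point set `P`. (If `P` is infinite and infinitely many of its subsets contribute, the value
is `0`; the random sets below are almost surely finite.) -/
def subsetCount {d : ℕ} (φ : Set (EuclideanSpace ℝ (Fin d)) → ℝ)
    (P : Set (EuclideanSpace ℝ (Fin d))) : ℝ :=
  ∑ᶠ Y ∈ {Y : Set (EuclideanSpace ℝ (Fin d)) | Y ⊆ P}, φ Y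

/-- `f` is a bounded probability density function on `ℝ^d`. -/
structure IsBoundedDensity {d : ℕ} (f : EuclideanSpace ℝ (Fin d) → ℝ) : Prop where
  measurable : Measurable f
  nonneg : ∀ x, 0 ≤ f x
  bounded : ∃ M : ℝ, ∀ x, f x ≤ M
  integrable : Integrable f volume
  integral_eq_one : ∫ x, f x = 1

/-- `X 0, X 1, …` are independent `ℝ^d`-valued random variables with common density `f`. -/
structure IsIIDSample {Ω : Type*} [MeasurableSpace Ω] (Pr : Measure Ω) {d : ℕ}
    (f : EuclideanSpace ℝ (Fin d) → ℝ) (X : ℕ → Ω → EuclideanSpace ℝ (Fin d)) : Prop where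
  measurable : ∀ i, Measurable (X i)
  law : ∀ i, Measure.map (X i) Pr = volume.withDensity (fun x => ENNReal.ofReal (f x))
  indep : iIndepFun X Pr

/-- The binomial point process `𝒳_n`: the random set of the first `n` sample points. -/
def binomialProcess {Ω : Type*} {d : ℕ} (X : ℕ → Ω → EuclideanSpace ℝ (Fin d)) (n : ℕ) (ω : Ω) :
    Set (EuclideanSpace ℝ (Fin d)) :=
  (fun i => X i ω) '' {i : ℕ | i < n}

/-- The random set `P` is a Poisson point process on `ℝ^d` with intensity function `lam`: the
number of points in every Borel set is a random variable, it is Poisson distributed with parameter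
`∫_A lam` whenever this integral is finite, and the numbers of points in pairwise disjoint
Borel sets are mutually independent. -/
structure IsPoissonProcess {Ω : Type*} [MeasurableSpace Ω] (Pr : Measure Ω) {d : ℕ}
    (lam : EuclideanSpace ℝ (Fin d) → ℝ) (P : Ω → Set (EuclideanSpace ℝ (Fin d))) : Prop where
  measurable : ∀ A : Set (EuclideanSpace ℝ (Fin d)), MeasurableSet A →
    Measurable (fun ω => (P ω ∩ A).encard)
  law : ∀ A : Set (EuclideanSpace ℝ (Fin d)), MeasurableSet A → IntegrableOn lam A volume →
    Measure.map (fun ω => (P ω ∩ A).encard) Pr =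
      (poissonMeasure (Real.toNNReal (∫ x in A, lam x))).map (fun k : ℕ => (k : ℕ∞))
  indep : ∀ (m : ℕ) (A : Fin m → Set (EuclideanSpace ℝ (Fin d))), (∀ i, MeasurableSet (A i)) →
    Pairwise (fun i j => Disjoint (A i) (A j)) →
    iIndepFun (fun (i : Fin m) (ω : Ω) => (P ω ∩ A i).encard) Pr

/-- The constant
`μ = (1 / p!) ∫ f(x)^p dx ∫_{(ℝ^d)^(p-1)} φ({0, x_1, …, x_{p-1}}) d(x_1, …, x_{p-1})`. -/
def limitConstant {d : ℕ} (f : EuclideanSpace ℝ (Fin d) → ℝ) (p : ℕ)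
    (φ : Set (EuclideanSpace ℝ (Fin d)) → ℝ) : ℝ :=
  1 / (p.factorial : ℝ) * (∫ x, f x ^ p) *
    ∫ y : Fin (p - 1) → EuclideanSpace ℝ (Fin d), φ (insert 0 (Set.range y))

end

open scoped ENNReal NNReal

/-! Since `g` vanishes off `p`-element sets, `p!` times the count is the number of ordered
`p`-tuples of points with `g = 1`. Let `I(r)` be the probability that `p` independent points of
density `f` have the property at radius `r`. The expected count is `n(n-1)⋯(n-p+1) I(r) / p!` for
the binomial process (sum over index embeddings) and `n^p I(r) / p!` for the Poisson process
(`measurable_count_tuples_and_lintegral_eq`: away from the diagonals, the expected tuple count is a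
product measure). The two differ by a factor tending to 1.

The substitution `x_i = x + r y_i` and the invariances of `g` give `I(r) = r^(d(p-1)) ∫∫ f(x) ∏ f(x
+ r y_i) g_1({0, y_1, …}) dy dx` (`integral_pi_eq_rescaled`), and `n^p r^(d(p-1))` is exactly the
normalisation. As `r → 0`, continuity of translation in `L¹` and dominated convergence give the
limit `∫ f^p ∫ g_1` (`tendsto_integral_integral_rescaled`); no continuity of `f` is needed. -/

/-! ### Subsets versus ordered tuples. -/

lemma Set.ncard_setOf_range_eq {α : Type*} {p : ℕ} {Y : Set α} (hY : Y.encard = p) :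
    {x : Fin p → α | Set.range x = Y}.ncard = p.factorial := by
  have hfin : Y.Finite := Set.finite_of_encard_eq_coe hY
  have := hfin.fintype
  have hc : Fintype.card Y = p := by
    have := Set.coe_fintypeCard Y
    rw [hY] at this
    exact_mod_cast this
  have hset : {x : Fin p → α | Set.range x = Y} =
      Set.range (fun (e : Fin p ≃ Y) (i : Fin p) => (e i : α)) := by
    ext x
    constructor
    · rintro h
      have h' : Set.range x = Y := h
      subst h'
      have hs : Function.Surjective (Set.rangeFactorization x) :=
        Set.rangeFactorization_surjective
      have hb : Function.Bijective (Set.rangeFactorization x) :=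
        (Fintype.bijective_iff_surjective_and_card _).2 ⟨hs, by simp [hc]⟩
      exact ⟨Equiv.ofBijective _ hb, rfl⟩
    · rintro ⟨e, rfl⟩
      change Set.range (Subtype.val ∘ e) = Y
      rw [Set.range_comp, e.surjective.range_eq, Set.image_univ, Subtype.range_coe]
  rw [hset, ← Nat.card_coe_set_eq, Nat.card_range_of_injective]
  · have e0 : Fin p ≃ Y := (Fintype.equivFinOfCardEq hc).symm
    classical
    rw [Nat.card_eq_fintype_card, Fintype.card_equiv e0, Fintype.card_fin]
  · intro e e' h
    ext i
    exact congrFun h i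

lemma injective_of_encard_range {α : Type*} {p : ℕ} {x : Fin p → α}
    (h : (Set.range x).encard = p) : Function.Injective x := by
  have h1 : (Set.range x).Finite := Set.finite_range x
  have := h1.fintype
  have hc : Fintype.card (Set.range x) = p := by
    have := Set.coe_fintypeCard (Set.range x)
    rw [h] at this
    exact_mod_cast this
  have hb : Function.Bijective (Set.rangeFactorization x) :=
    (Fintype.bijective_iff_surjective_and_card _).2
      ⟨Set.rangeFactorization_surjective, by simp [hc]⟩
  intro i j hij
  exact hb.1 (Subtype.ext hij)

/-- Fibre the tuples over their range: a set `Y` with `φ Y = 1` has exactly `p` elements, hence `p!`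
orderings, and all other fibres are empty. -/
lemma factorial_mul_subsetCount {d p : ℕ} {φ : Set (EuclideanSpace ℝ (Fin d)) → ℝ}
    (hφ : ∀ Y, φ Y = 0 ∨ φ Y = 1) (hp : ∀ Y, Y.encard ≠ (p : ℕ∞) → φ Y = 0)
    {P : Set (EuclideanSpace ℝ (Fin d))} (hP : P.Finite) :
    (p.factorial : ℝ) * subsetCount φ P =
      ({x : Fin p → EuclideanSpace ℝ (Fin d) |
        (∀ i, x i ∈ P) ∧ φ (Set.range x) = 1}.ncard : ℝ) := by
  classical
  set T := {x : Fin p → EuclideanSpace ℝ (Fin d) | (∀ i, x i ∈ P) ∧ φ (Set.range x) = 1}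
  have hT : T.Finite :=
    (Set.Finite.pi (fun _ : Fin p => hP)).subset fun x hx i _ => hx.1 i
  have hS : {Y : Set (EuclideanSpace ℝ (Fin d)) | Y ⊆ P}.Finite := hP.finite_subsets
  rw [subsetCount, finsum_mem_eq_finite_toFinset_sum _ hS, Finset.mul_sum,
    Set.ncard_eq_toFinset_card T hT,
    Finset.card_eq_sum_card_fiberwise (f := Set.range) (t := hS.toFinset)]
  · push_cast
    refine Finset.sum_congr rfl fun Y hY => ?_
    have hYP : Y ⊆ P := by simpa using hY
    have hcoe : ((hT.toFinset.filter fun x => Set.range x = Y).card : ℕ) =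
        (T ∩ {x | Set.range x = Y}).ncard := by
      rw [← Set.ncard_coe_finset]
      congr 1
      ext x
      simp
    rw [hcoe]
    rcases hφ Y with h | h
    · have : T ∩ {x | Set.range x = Y} = ∅ := by
        ext x
        simp only [Set.mem_inter_iff, Set.mem_ofPred_eq, Set.mem_empty_iff_false, iff_false, T]
        rintro ⟨⟨-, h1⟩, rfl⟩
        rw [h1] at h
        exact one_ne_zero h
      simp [this, h]
    · have hc : Y.encard = p := by
        by_contra hne
        rw [hp Y hne] at h
        exact zero_ne_one h
      have : T ∩ {x | Set.range x = Y} = {x | Set.range x = Y} := by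
        refine Set.inter_eq_right.2 ?_
        rintro x hx
        have hx' : Set.range x = Y := hx
        exact ⟨fun i => hYP (hx' ▸ Set.mem_range_self i), by rw [hx', h]⟩
      rw [this, Set.ncard_setOf_range_eq hc, h, mul_one]
  · intro x hx
    have hx' : x ∈ T := by simpa using hx
    simp only [Set.Finite.coe_toFinset, Set.mem_ofPred_eq]
    rintro _ ⟨i, rfl⟩
    exact hx'.1 i

lemma factorial_mul_subsetCount_range {d p n : ℕ} {φ : Set (EuclideanSpace ℝ (Fin d)) → ℝ}
    (hφ : ∀ Y, φ Y = 0 ∨ φ Y = 1) (hp : ∀ Y, Y.encard ≠ (p : ℕ∞) → φ Y = 0)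
    {Z : Fin n → EuclideanSpace ℝ (Fin d)} (hZ : Function.Injective Z) :
    (p.factorial : ℝ) * subsetCount φ (Set.range Z) =
      ∑ σ : Fin p ↪ Fin n, φ (Set.range (fun i => Z (σ i))) := by
  classical
  rw [factorial_mul_subsetCount hφ hp (Set.finite_range Z)]
  have hsum : ∀ σ : Fin p ↪ Fin n, φ (Set.range (fun i => Z (σ i))) =
      if φ (Set.range (fun i => Z (σ i))) = 1 then 1 else 0 := by
    intro σ
    rcases hφ (Set.range (fun i => Z (σ i))) with h | h <;> simp [h]
  rw [Finset.sum_congr rfl fun σ _ => hsum σ, Finset.sum_boole, Nat.cast_inj]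
  have hinj : Function.Injective
      (fun (σ : Fin p ↪ Fin n) (i : Fin p) => Z (σ i)) := by
    intro σ τ h
    ext i
    exact congrArg Fin.val (hZ (congrFun h i))
  rw [← Set.ncard_coe_finset, ← Set.ncard_image_of_injective _ hinj]
  congr 1
  ext x
  simp only [Set.mem_range, Set.mem_ofPred_eq, Finset.coe_filter, Finset.mem_univ, true_and,
    Set.mem_image]
  constructor
  · rintro ⟨h1, h2⟩
    have hx : Function.Injective x := injective_of_encard_range (by
      by_contra hne
      rw [hp _ hne] at h2
      exact zero_ne_one h2)
    choose τ hτ using h1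
    obtain rfl : x = fun i => Z (τ i) := funext fun i => (hτ i).symm
    exact ⟨⟨τ, fun i j hij => hx (by simp [hij])⟩, h2, rfl⟩
  · rintro ⟨σ, h, rfl⟩
    exact ⟨fun i => ⟨σ i, rfl⟩, h⟩

/-! ### Expected tuple counts for a random set with independent counts. -/

lemma count_univ_pi {ι α : Type*} [Fintype ι] [MeasurableSpace α]
    [MeasurableSingletonClass α] {s : ι → Set α} (hs : ∀ i, (s i).Finite) :
    Measure.count (Set.univ.pi s) = ∏ i, ((s i).encard : ℝ≥0∞) := by
  classical
  have h : Set.univ.pi s = (Fintype.piFinset fun i => (hs i).toFinset : Set (ι → α)) := by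
    ext x; simp
  rw [h, Measure.count_apply_finset, Fintype.card_piFinset, Nat.cast_prod]
  refine Finset.prod_congr rfl fun i _ => ?_
  rw [(hs i).encard_eq_coe_toFinset_card]
  simp

lemma measurable_encard_toENNReal {Ω α : Type*} [MeasurableSpace Ω] [MeasurableSpace α] {P : Ω → Set α}
    (hm : ∀ A, MeasurableSet A → Measurable fun ω => (P ω ∩ A).encard) {A : Set α}
    (hA : MeasurableSet A) : Measurable fun ω => ((P ω ∩ A).encard : ℝ≥0∞) :=
  (Measurable.of_discrete (f := fun k : ℕ∞ => (k : ℝ≥0∞))).comp (hm A hA)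

/-- Counting measure on the tuples whose `i`-th coordinate lies in `P ∩ B i`. -/
noncomputable def tupleCount {p : ℕ} {α : Type*} [MeasurableSpace α] (P : Set α)
    (B : Fin p → Set α) : Measure (Fin p → α) :=
  Measure.count.restrict (Set.univ.pi fun i => P ∩ B i)

section

variable {Ω α : Type*} [MeasurableSpace Ω] [MeasurableSpace α] [MeasurableSingletonClass α]
  {Pr : Measure Ω} {p : ℕ} {P : Ω → Set α}

lemma tupleCount_apply_pi {P : Set α} (hP : P.Finite) (B : Fin p → Set α) {A : Fin p → Set α}
    (hA : ∀ i, MeasurableSet (A i)) :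
    tupleCount P B (Set.univ.pi A) = ∏ i, ((P ∩ (A i ∩ B i)).encard : ℝ≥0∞) := by
  rw [tupleCount, Measure.restrict_apply (MeasurableSet.univ_pi hA), ← Set.pi_inter_distrib,
    ← count_univ_pi fun i => hP.subset Set.inter_subset_left]
  congr 2
  ext i
  simp only [Set.mem_inter_iff]
  tauto

lemma isFiniteMeasure_tupleCount {P : Set α} (hP : P.Finite) (B : Fin p → Set α) :
    IsFiniteMeasure (tupleCount P B) := by
  refine ⟨?_⟩
  rw [tupleCount, Measure.restrict_apply_univ, Measure.count_apply_lt_top]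
  exact Set.Finite.pi fun i => hP.subset Set.inter_subset_left

lemma measurable_tupleCount (hfin : ∀ ω, (P ω).Finite)
    (hm : ∀ A, MeasurableSet A → Measurable fun ω => (P ω ∩ A).encard)
    {B : Fin p → Set α} (hB : ∀ i, MeasurableSet (B i)) :
    Measurable fun ω => tupleCount (P ω) B := by
  have := fun ω => isFiniteMeasure_tupleCount (hfin ω) B
  have key : ∀ A : Fin p → Set α, (∀ i, MeasurableSet (A i)) →
      Measurable fun ω => tupleCount (P ω) B (Set.univ.pi A) := by
    intro A hA
    simp_rw [fun ω => tupleCount_apply_pi (hfin ω) B hA]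
    exact Finset.measurable_prod _ fun i _ =>
      measurable_encard_toENNReal hm ((hA i).inter (hB i))
  refine Measurable.measure_of_isPiSystem generateFrom_pi.symm isPiSystem_pi ?_ ?_
  · rintro _ ⟨A, hA, rfl⟩
    exact key A fun i => hA i trivial
  · simpa using key (fun _ => Set.univ) fun _ => MeasurableSet.univ

/-- On boxes inside a product of disjoint sets `B i`, the tuple count is a product of independent
counts, so its mean factorises. Boxes form a generating π-system and the measures are finite, so the
identity extends to all measurable sets. -/
lemma lintegral_tupleCount (hfin : ∀ ω, (P ω).Finite)
    (hm : ∀ A, MeasurableSet A → Measurable fun ω => (P ω ∩ A).encard)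
    {μ : Measure α} [IsFiniteMeasure μ] {c : ℝ≥0∞}
    (hmean : ∀ A, MeasurableSet A → ∫⁻ ω, ((P ω ∩ A).encard : ℝ≥0∞) ∂Pr = c * μ A) (hc : c ≠ ∞)
    (hind : ∀ (A : Fin p → Set α), (∀ i, MeasurableSet (A i)) →
      Pairwise (fun i j => Disjoint (A i) (A j)) →
      iIndepFun (fun i ω => (P ω ∩ A i).encard) Pr)
    {B : Fin p → Set α} (hB : ∀ i, MeasurableSet (B i))
    (hdisj : Pairwise (fun i j => Disjoint (B i) (B j)))
    {S : Set (Fin p → α)} (hS : MeasurableSet S) (hSB : S ⊆ Set.univ.pi B) :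
    ∫⁻ ω, tupleCount (P ω) B S ∂Pr = c ^ p * Measure.pi (fun _ => μ) S := by
  have hν := measurable_tupleCount hfin hm hB
  have key : ∀ A : Fin p → Set α, (∀ i, MeasurableSet (A i)) →
      (c ^ p • (Measure.pi fun _ : Fin p => μ).restrict (Set.univ.pi B)) (Set.univ.pi A) =
        (Pr.bind fun ω => tupleCount (P ω) B) (Set.univ.pi A) := by
    intro A hA
    have hAB : ∀ i, MeasurableSet (A i ∩ B i) := fun i => (hA i).inter (hB i)
    rw [Measure.bind_apply (MeasurableSet.univ_pi hA) hν.aemeasurable]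
    simp_rw [fun ω => tupleCount_apply_pi (hfin ω) B hA]
    have hi : iIndepFun (fun i ω => ((P ω ∩ (A i ∩ B i)).encard : ℝ≥0∞)) Pr :=
      (hind (fun i => A i ∩ B i) hAB fun i j hij =>
        (hdisj hij).mono Set.inter_subset_right Set.inter_subset_right).comp
          (fun _ k => (k : ℝ≥0∞)) fun _ => Measurable.of_discrete
    rw [lintegral_prod_eq_prod_lintegral_of_indepFun _ _ hi
      fun i => measurable_encard_toENNReal hm (hAB i),
      Finset.prod_congr rfl fun i _ => hmean _ (hAB i), Finset.prod_mul_distrib,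
      Measure.smul_apply, Measure.restrict_apply (MeasurableSet.univ_pi hA),
      ← Set.pi_inter_distrib, Measure.pi_pi]
    simp
  have hext : c ^ p • (Measure.pi fun _ : Fin p => μ).restrict (Set.univ.pi B) =
      Pr.bind fun ω => tupleCount (P ω) B := by
    have : IsFiniteMeasure (c ^ p • (Measure.pi fun _ : Fin p => μ).restrict (Set.univ.pi B)) :=
      Measure.smul_finite _ (ENNReal.pow_ne_top hc)
    refine ext_of_generate_finite _ generateFrom_pi.symm isPiSystem_pi ?_ ?_
    · rintro _ ⟨A, hA, rfl⟩
      exact key A fun i => hA i trivial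
    · simpa using key (fun _ => Set.univ) fun _ => MeasurableSet.univ
  rw [← Measure.bind_apply hS hν.aemeasurable, ← hext, Measure.smul_apply,
    Measure.restrict_apply hS, Set.inter_eq_left.2 hSB, smul_eq_mul]

end

/-- Finitely many distinct points of a Hausdorff space are separated by disjoint basic open sets,
and a countable basis yields only countably many boxes of such sets. -/
lemma exists_disjoint_boxes_cover (α : Type*) [TopologicalSpace α] [T2Space α]
    [SecondCountableTopology α] (p : ℕ) :
    ∃ R : ℕ → Fin p → Set α, (∀ k i, IsOpen (R k i)) ∧
      (∀ k, Pairwise fun i j => Disjoint (R k i) (R k j)) ∧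
      ∀ x : Fin p → α, Function.Injective x → ∃ k, x ∈ Set.univ.pi (R k) := by
  set b := TopologicalSpace.countableBasis α
  have hb := TopologicalSpace.isBasis_countableBasis α
  -- The constant empty box only ensures that the family is nonempty, so that it can be enumerated
  -- by `ℕ`.
  set C : Set (Fin p → Set α) :=
    insert (fun _ => ∅) ({B | (∀ i, B i ∈ b) ∧ Pairwise fun i j => Disjoint (B i) (B j)})
  have hC : C.Countable := by
    refine Set.Countable.insert _ ?_
    refine (Set.countable_univ_pi fun _ : Fin p =>
      TopologicalSpace.countable_countableBasis α).mono ?_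
    exact fun B hB i _ => hB.1 i
  obtain ⟨R, hR⟩ := hC.exists_eq_range ⟨_, Set.mem_insert _ _⟩
  have hmem : ∀ k, R k ∈ C := fun k => hR ▸ Set.mem_range_self k
  refine ⟨R, fun k i => ?_, fun k => ?_, fun x hx => ?_⟩
  · rcases hmem k with h | h
    · simp [h]
    · exact hb.isOpen (h.1 i)
  · rcases hmem k with h | h
    · rw [h]; intro i j _; simp
    · exact h.2
  · obtain ⟨U, hU, hd⟩ := (Set.finite_range x).t2_separation
    have : ∀ i, ∃ B ∈ b, x i ∈ B ∧ B ⊆ U (x i) := fun i =>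
      hb.exists_subset_of_mem_open (hU (x i)).1 (hU (x i)).2
    choose B hBb hxB hBU using this
    have hB : B ∈ C := Or.inr ⟨hBb, fun i j hij =>
      (hd ⟨i, rfl⟩ ⟨j, rfl⟩ (hx.ne hij)).mono (hBU i) (hBU j)⟩
    rw [hR] at hB
    obtain ⟨k, rfl⟩ := hB
    exact ⟨k, fun i _ => hxB i⟩

section

variable {Ω α : Type*} [MeasurableSpace Ω] [TopologicalSpace α] [T2Space α]
  [SecondCountableTopology α] [MeasurableSpace α] [BorelSpace α]
  {Pr : Measure Ω} {p : ℕ} {P : Ω → Set α}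

/-- Independence is available only for disjoint sets, so a set of injective tuples is cut into
countably many pieces, each inside a box with disjoint sides, and the means are summed. -/
lemma measurable_count_tuples_and_lintegral_eq (hfin : ∀ ω, (P ω).Finite)
    (hm : ∀ A, MeasurableSet A → Measurable fun ω => (P ω ∩ A).encard)
    {μ : Measure α} [IsFiniteMeasure μ] {c : ℝ≥0∞}
    (hmean : ∀ A, MeasurableSet A → ∫⁻ ω, ((P ω ∩ A).encard : ℝ≥0∞) ∂Pr = c * μ A) (hc : c ≠ ∞)
    (hind : ∀ (A : Fin p → Set α), (∀ i, MeasurableSet (A i)) →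
      Pairwise (fun i j => Disjoint (A i) (A j)) →
      iIndepFun (fun i ω => (P ω ∩ A i).encard) Pr)
    {S : Set (Fin p → α)} (hS : MeasurableSet S) (hSinj : ∀ x ∈ S, Function.Injective x) :
    Measurable (fun ω => Measure.count (S ∩ {x | ∀ i, x i ∈ P ω})) ∧
    ∫⁻ ω, Measure.count (S ∩ {x | ∀ i, x i ∈ P ω}) ∂Pr =
      c ^ p * Measure.pi (fun _ => μ) S := by
  obtain ⟨R, hRo, hRd, hRc⟩ := exists_disjoint_boxes_cover α p
  have hRm : ∀ k i, MeasurableSet (R k i) := fun k i => (hRo k i).measurableSet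
  set D : ℕ → Set (Fin p → α) := fun k => S ∩ disjointed (fun k => Set.univ.pi (R k)) k
  have hDm : ∀ k, MeasurableSet (D k) := fun k => hS.inter <|
    MeasurableSet.disjointed (fun k => MeasurableSet.univ_pi (hRm k)) k
  have hDR : ∀ k, D k ⊆ Set.univ.pi (R k) := fun k =>
    Set.inter_subset_right.trans (disjointed_subset _ k)
  have hDd : Pairwise (fun i j => Disjoint (D i) (D j)) := fun i j hij =>
    (disjoint_disjointed _ hij).mono Set.inter_subset_right Set.inter_subset_right
  have hDU : S = ⋃ k, D k := by
    rw [← Set.inter_iUnion, iUnion_disjointed, eq_comm, Set.inter_eq_left]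
    intro x hx
    exact Set.mem_iUnion.2 (hRc x (hSinj x hx))
  have hT : ∀ ω, MeasurableSet {x : Fin p → α | ∀ i, x i ∈ P ω} := fun ω => by
    have : {x : Fin p → α | ∀ i, x i ∈ P ω} = Set.univ.pi fun _ => P ω := by ext; simp
    rw [this]
    exact (Set.Finite.pi fun _ => hfin ω).measurableSet
  have hcount : ∀ ω, Measure.count (S ∩ {x | ∀ i, x i ∈ P ω}) =
      ∑' k, tupleCount (P ω) (R k) (D k) := by
    intro ω
    conv_lhs => rw [hDU, Set.iUnion_inter]
    rw [measure_iUnion]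
    · refine tsum_congr fun k => ?_
      rw [tupleCount, Measure.restrict_apply (hDm k)]
      congr 1
      ext x
      simp only [Set.mem_inter_iff, Set.mem_ofPred_eq, Set.mem_pi, Set.mem_univ, true_implies]
      constructor
      · rintro ⟨h1, h2⟩
        exact ⟨h1, fun i => ⟨h2 i, hDR k h1 i trivial⟩⟩
      · rintro ⟨h1, h2⟩
        exact ⟨h1, fun i => (h2 i).1⟩
    · exact fun i j hij => (hDd hij).mono Set.inter_subset_left Set.inter_subset_left
    · exact fun k => (hDm k).inter (hT ω)
  have hmeas : ∀ k, Measurable fun ω => tupleCount (P ω) (R k) (D k) := fun k =>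
    (Measure.measurable_coe (hDm k)).comp (measurable_tupleCount hfin hm (hRm k))
  simp_rw [hcount]
  refine ⟨Measurable.tsum hmeas, ?_⟩
  rw [lintegral_tsum fun k => (hmeas k).aemeasurable]
  simp_rw [fun k => lintegral_tupleCount hfin hm hmean hc hind (hRm k) (hRd k) (hDm k) (hDR k)]
  rw [ENNReal.tsum_mul_left, ← measure_iUnion hDd hDm, ← hDU]

end

/-! ### Rescaled integrals against a bounded density. -/

/-- This is continuity of the translation action on `L¹`, evaluated at the class of `f`. -/
lemma tendsto_integral_abs_translate_sub {d : ℕ} {f : EuclideanSpace ℝ (Fin d) → ℝ}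
    (hf : Integrable f) :
    Tendsto (fun t => ∫ x, |f (x + t) - f x|) (𝓝 0) (𝓝 0) := by
  have : Fact ((1 : ℝ≥0∞) ≤ 1) := ⟨le_rfl⟩
  have : Fact ((1 : ℝ≥0∞) ≠ ∞) := ⟨ENNReal.one_ne_top⟩
  set F : Lp ℝ 1 (volume : Measure (EuclideanSpace ℝ (Fin d))) := hf.toL1 f
  have hc : Continuous fun t : EuclideanSpace ℝ (Fin d) => DomAddAct.mk t +ᵥ F := by
    have h1 : Continuous (DomAddAct.mk : EuclideanSpace ℝ (Fin d) → _) :=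
      DomAddAct.continuous_mk
    exact h1.vadd continuous_const
  have h0 : Tendsto (fun t : EuclideanSpace ℝ (Fin d) => ‖(DomAddAct.mk t +ᵥ F) - F‖)
      (𝓝 0) (𝓝 0) := by
    have := ((hc.sub (continuous_const : Continuous fun _ => F)).norm).tendsto 0
    simpa using this
  refine h0.congr fun t => ?_
  rw [L1.norm_eq_integral_norm]
  refine integral_congr_ae ?_
  have hF : F =ᵐ[volume] f := hf.coeFn_toL1
  have hFt : (fun x => F (t +ᵥ x)) =ᵐ[volume] fun x => f (t +ᵥ x) :=
    (measurePreserving_vadd t volume).quasiMeasurePreserving.ae_eq_comp hF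
  filter_upwards [Lp.coeFn_sub (DomAddAct.mk t +ᵥ F) F, hF, hFt,
    DomAddAct.vadd_Lp_ae_eq (DomAddAct.mk t) F] with x h1 h2 h3 h4
  rw [h1, Pi.sub_apply, h4, Real.norm_eq_abs, h2]
  have h5 : DomAddAct.mk.symm (DomAddAct.mk t) = t := rfl
  rw [h5, h3, vadd_eq_add, add_comm]

lemma pi_withDensity_ofReal {ι α : Type*} [Fintype ι] [MeasureSpace α]
    [SigmaFinite (volume : Measure α)] {f : α → ℝ} (hf : Integrable f) (h0 : ∀ x, 0 ≤ f x)
    [SigmaFinite ((volume : Measure α).withDensity fun x => ENNReal.ofReal (f x))] :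
    (Measure.pi fun _ : ι => (volume : Measure α).withDensity fun x => ENNReal.ofReal (f x)) =
      (volume : Measure (ι → α)).withDensity fun x => ENNReal.ofReal (∏ i, f (x i)) := by
  refine Measure.pi_eq fun s hs => ?_
  rw [withDensity_apply _ (MeasurableSet.univ_pi hs), volume_pi, Measure.restrict_pi_pi,
    ← ofReal_integral_eq_lintegral_ofReal, integral_fintype_prod_eq_prod (fun _ => f),
    ENNReal.ofReal_prod_of_nonneg]
  · refine Finset.prod_congr rfl fun i _ => ?_
    rw [withDensity_apply _ (hs i), ofReal_integral_eq_lintegral_ofReal hf.restrict]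
    exact ae_of_all _ h0
  · exact fun i _ => integral_nonneg h0
  · exact Integrable.fintype_prod fun i => hf.restrict
  · exact ae_of_all _ fun x => Finset.prod_nonneg fun i _ => h0 _

namespace IsBoundedDensity

variable {d : ℕ} {f : EuclideanSpace ℝ (Fin d) → ℝ}

lemma isProbabilityMeasure (hf : IsBoundedDensity f) :
    IsProbabilityMeasure
      ((volume : Measure (EuclideanSpace ℝ (Fin d))).withDensity
        fun x => ENNReal.ofReal (f x)) := by
  refine ⟨?_⟩
  rw [withDensity_apply _ MeasurableSet.univ, Measure.restrict_univ,
    ← ofReal_integral_eq_lintegral_ofReal hf.integrable (ae_of_all _ hf.nonneg),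
    hf.integral_eq_one, ENNReal.ofReal_one]

lemma integrable_pow (hf : IsBoundedDensity f) {p : ℕ} (hp : p ≠ 0) :
    Integrable fun x => f x ^ p := by
  obtain ⟨M, hM⟩ := hf.bounded
  obtain ⟨q, rfl⟩ := Nat.exists_eq_succ_of_ne_zero hp
  refine (hf.integrable.mul_const (M ^ q)).mono'
    (hf.measurable.pow_const _).aestronglyMeasurable (ae_of_all _ fun x => ?_)
  rw [Real.norm_of_nonneg (pow_nonneg (hf.nonneg x) _), pow_succ']
  exact mul_le_mul_of_nonneg_left (pow_le_pow_left₀ (hf.nonneg x) (hM x) _) (hf.nonneg x)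

lemma prod_le_pow (hf : IsBoundedDensity f) {M : ℝ} (hM : ∀ x, f x ≤ M) {ι : Type*}
    (s : Finset ι) (z : ι → EuclideanSpace ℝ (Fin d)) :
    ∏ i ∈ s, f (z i) ≤ M ^ s.card := by
  rw [← Finset.prod_const]
  exact Finset.prod_le_prod (fun i _ => hf.nonneg _) fun i _ => hM _

lemma integrable_mul_prod_translate (hf : IsBoundedDensity f) {ι : Type*} (s : Finset ι)
    (y : ι → EuclideanSpace ℝ (Fin d)) :
    Integrable fun x => f x * ∏ i ∈ s, f (x + y i) := by
  obtain ⟨M, hM⟩ := hf.bounded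
  refine (hf.integrable.mul_const (M ^ s.card)).mono' ?_ (ae_of_all _ fun x => ?_)
  · refine Measurable.aestronglyMeasurable (hf.measurable.mul ?_)
    exact Finset.measurable_prod _ fun i _ => hf.measurable.comp (measurable_id.add_const _)
  · rw [Real.norm_of_nonneg (mul_nonneg (hf.nonneg x)
      (Finset.prod_nonneg fun i _ => hf.nonneg _))]
    exact mul_le_mul_of_nonneg_left
      (hf.prod_le_pow hM s _) (hf.nonneg x)

lemma integral_mul_prod_translate_le (hf : IsBoundedDensity f) {M : ℝ} (hM : ∀ x, f x ≤ M)
    {ι : Type*} (s : Finset ι) (y : ι → EuclideanSpace ℝ (Fin d)) :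
    ∫ x, f x * ∏ i ∈ s, f (x + y i) ≤ M ^ s.card := by
  calc ∫ x, f x * ∏ i ∈ s, f (x + y i) ≤ ∫ x, f x * M ^ s.card :=
        integral_mono (hf.integrable_mul_prod_translate s y) (hf.integrable.mul_const _)
          fun x => mul_le_mul_of_nonneg_left
            (hf.prod_le_pow hM s _) (hf.nonneg x)
    _ = M ^ s.card := by rw [integral_mul_const, hf.integral_eq_one, one_mul]

lemma tendsto_integral_mul_prod_translate (hf : IsBoundedDensity f) {ι : Type*} (s : Finset ι)
    {y : ℕ → ι → EuclideanSpace ℝ (Fin d)} (hy : ∀ i, Tendsto (fun n => y n i) atTop (𝓝 0)) :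
    Tendsto (fun n => ∫ x, f x * ∏ i ∈ s, f (x + y n i)) atTop
      (𝓝 (∫ x, f x ^ (s.card + 1))) := by
  classical
  obtain ⟨M, hM⟩ := hf.bounded
  have hM0 : 0 ≤ M := (hf.nonneg 0).trans (hM 0)
  -- `L¹` convergence of the integrands is stronger than the claim, but it can be proved by
  -- induction on the factors.
  suffices h : Tendsto (fun n => ∫ x, |f x * ∏ i ∈ s, f (x + y n i) - f x ^ (s.card + 1)|)
      atTop (𝓝 0) by
    rw [tendsto_iff_norm_sub_tendsto_zero]
    refine squeeze_zero (fun n => norm_nonneg _) (fun n => ?_) h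
    rw [← integral_sub (hf.integrable_mul_prod_translate s _)
      (hf.integrable_pow (Nat.succ_ne_zero _))]
    exact norm_integral_le_integral_norm _
  induction s using Finset.induction_on with
  | empty => simp
  | insert j s hj ih =>
    have ht := (tendsto_integral_abs_translate_sub hf.integrable).comp (hy j)
    have hlim := (ih.mul_const M).add (ht.mul_const (M ^ (s.card + 1)))
    simp only [zero_mul, add_zero, Function.comp_def] at hlim
    refine squeeze_zero (fun n => integral_nonneg fun x => abs_nonneg _) (fun n => ?_) hlim
    have hi1 : Integrable fun x => |f x * ∏ i ∈ s, f (x + y n i) - f x ^ (s.card + 1)| :=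
      ((hf.integrable_mul_prod_translate s _).sub
        (hf.integrable_pow (Nat.succ_ne_zero _))).abs
    have hi2 : Integrable fun x => |f (x + y n j) - f x| :=
      ((hf.integrable.comp_add_right _).sub hf.integrable).abs
    rw [← integral_mul_const, ← integral_mul_const,
      ← integral_add (hi1.mul_const _) (hi2.mul_const _)]
    refine integral_mono ?_ ((hi1.mul_const _).add (hi2.mul_const _)) fun x => ?_
    · exact ((hf.integrable_mul_prod_translate (insert j s) (y n)).sub
        (hf.integrable_pow (Nat.succ_ne_zero _))).abs
    · simp only
      rw [Finset.prod_insert hj, Finset.card_insert_of_notMem hj]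
      -- Telescoping: only the factor `j` is replaced by `f x`. The first term is bounded by `M`
      -- times the induction hypothesis, the second by `M ^ (s.card + 1)` times an `L¹` translation
      -- error.
      have e : f x * (f (x + y n j) * ∏ i ∈ s, f (x + y n i)) - f x ^ (s.card + 1 + 1) =
          (f x * ∏ i ∈ s, f (x + y n i) - f x ^ (s.card + 1)) * f (x + y n j) +
            (f (x + y n j) - f x) * f x ^ (s.card + 1) := by ring
      rw [e]
      refine (abs_add_le _ _).trans ?_
      rw [abs_mul, abs_mul, abs_of_nonneg (hf.nonneg _), abs_of_nonneg (pow_nonneg (hf.nonneg x) _)]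
      gcongr
      · exact hM _
      · exact hf.nonneg x
      · exact hM x

/-- The rescaled integrals of a bounded integrable function against a bounded density converge. -/
lemma tendsto_integral_integral_rescaled (hf : IsBoundedDensity f) {q : ℕ}
    {φ : (Fin q → EuclideanSpace ℝ (Fin d)) → ℝ} (hφ : Integrable φ) {r : ℕ → ℝ}
    (hr0 : Tendsto r atTop (𝓝 0)) :
    Tendsto (fun n => ∫ x, ∫ y : Fin q → EuclideanSpace ℝ (Fin d),
        f x * (∏ i, f (x + r n • y i)) * φ y) atTop
      (𝓝 ((∫ x, f x ^ (q + 1)) * ∫ y, φ y)) := by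
  obtain ⟨M, hM⟩ := hf.bounded
  have hint : ∀ n, Integrable (fun z : EuclideanSpace ℝ (Fin d) ×
      (Fin q → EuclideanSpace ℝ (Fin d)) =>
        f z.1 * (∏ i, f (z.1 + r n • z.2 i)) * φ z.2) (volume.prod volume) := by
    intro n
    have h1 : Integrable (fun z : EuclideanSpace ℝ (Fin d) ×
      (Fin q → EuclideanSpace ℝ (Fin d)) => (∏ i, f (z.1 + r n • z.2 i)) * (f z.1 * φ z.2))
        (volume.prod volume) := by
      refine (hf.integrable.mul_prod hφ).bdd_mul (c := M ^ q) ?_ (ae_of_all _ fun z => ?_)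
      · refine Measurable.aestronglyMeasurable (Finset.measurable_prod _ fun i _ => ?_)
        exact hf.measurable.comp (by fun_prop)
      · rw [Real.norm_of_nonneg (Finset.prod_nonneg fun i _ => hf.nonneg _)]
        simpa using hf.prod_le_pow hM Finset.univ
          (fun i => z.1 + r n • z.2 i)
    refine h1.congr (ae_of_all _ fun z => ?_)
    simp only
    ring
  -- With `y` outside, the inner integral converges for each fixed `y` and is bounded by `M ^ q`, so
  -- dominated convergence in `y` applies.
  have hswap : ∀ n, ∫ x, ∫ y : Fin q → EuclideanSpace ℝ (Fin d),
        f x * (∏ i, f (x + r n • y i)) * φ y =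
      ∫ y : Fin q → EuclideanSpace ℝ (Fin d),
        (∫ x, f x * ∏ i, f (x + r n • y i)) * φ y := by
    intro n
    rw [integral_integral_swap (hint n)]
    simp_rw [integral_mul_const]
  simp_rw [hswap]
  rw [← integral_const_mul]
  refine tendsto_integral_of_dominated_convergence (fun y => M ^ q * ‖φ y‖) (fun n => ?_)
    (hφ.norm.const_mul _) (fun n => ae_of_all _ fun y => ?_) (ae_of_all _ fun y => ?_)
  · have := (hint n).integral_prod_right.aestronglyMeasurable
    simpa only [integral_mul_const] using this
  · rw [norm_mul, Real.norm_of_nonneg (integral_nonneg fun x => mul_nonneg (hf.nonneg x)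
      (Finset.prod_nonneg fun i _ => hf.nonneg _))]
    gcongr
    simpa using hf.integral_mul_prod_translate_le hM Finset.univ fun i => r n • y i
  · have := hf.tendsto_integral_mul_prod_translate (Finset.univ : Finset (Fin q))
      (y := fun n i => r n • y i) fun i => by simpa using hr0.smul_const (y i)
    simpa using this.mul_const (φ y)

end IsBoundedDensity

/-! ### First moments of the counts for both processes. -/

lemma lintegral_poissonMeasure_id (l : ℝ≥0) :
    ∫⁻ k, (k : ℝ≥0∞) ∂(poissonMeasure l) = l := by
  have hs : HasSum (fun k : ℕ => Real.exp (-l) * l ^ k / k.factorial * k) (l : ℝ) := by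
    -- The term `k = 0` vanishes; after the shift, `l^(k+1)/(k+1)! · (k+1) = l · l^k/k!`.
    rw [← hasSum_nat_add_iff' 1]
    simp only [Finset.range_one, Finset.sum_singleton, Nat.cast_zero, mul_zero, sub_zero]
    have := (hasSum_one_poissonMeasure l).mul_left (l : ℝ)
    rw [mul_one] at this
    refine this.congr_fun fun k => ?_
    rw [Nat.factorial_succ]
    push_cast
    field_simp
    ring
  rw [poissonMeasure, lintegral_sum_measure]
  simp_rw [lintegral_smul_measure, lintegral_dirac, smul_eq_mul]
  have : ∀ k : ℕ, ENNReal.ofReal (Real.exp (-l) * l ^ k / k.factorial) * (k : ℝ≥0∞) =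
      ENNReal.ofReal (Real.exp (-l) * l ^ k / k.factorial * k) := fun k => by
    rw [ENNReal.ofReal_mul (by positivity), ENNReal.ofReal_natCast]
  simp_rw [this]
  rw [← ENNReal.ofReal_tsum_of_nonneg (fun k => by positivity) hs.summable, hs.tsum_eq,
    ENNReal.ofReal_coe_nnreal]

section

variable {Ω : Type*} [MeasurableSpace Ω] {Pr : Measure Ω} {d : ℕ}
  {f : EuclideanSpace ℝ (Fin d) → ℝ}

lemma IsPoissonProcess.lintegral_encard {P : Ω → Set (EuclideanSpace ℝ (Fin d))} {n : ℕ}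
    (hP : IsPoissonProcess Pr (fun x => (n : ℝ) * f x) P) (hf : IsBoundedDensity f)
    {A : Set (EuclideanSpace ℝ (Fin d))} (hA : MeasurableSet A) :
    ∫⁻ ω, ((P ω ∩ A).encard : ℝ≥0∞) ∂Pr =
      n * (volume.withDensity fun x => ENNReal.ofReal (f x)) A := by
  have h1 : ∫⁻ ω, ((P ω ∩ A).encard : ℝ≥0∞) ∂Pr =
      ∫⁻ k : ℕ∞, (k : ℝ≥0∞) ∂(Pr.map fun ω => (P ω ∩ A).encard) :=
    (lintegral_map Measurable.of_discrete (hP.measurable A hA)).symm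
  rw [h1, hP.law A hA (hf.integrable.const_mul _).integrableOn,
    lintegral_map Measurable.of_discrete Measurable.of_discrete]
  simp only [ENat.toENNReal_coe]
  rw [lintegral_poissonMeasure_id, integral_const_mul, withDensity_apply _ hA,
    ← ofReal_integral_eq_lintegral_ofReal hf.integrable.restrict (ae_of_all _ hf.nonneg),
    ← ENNReal.ofReal, ENNReal.ofReal_mul (Nat.cast_nonneg n), ENNReal.ofReal_natCast]

lemma IsPoissonProcess.ae_finite {P : Ω → Set (EuclideanSpace ℝ (Fin d))} {n : ℕ}
    (hP : IsPoissonProcess Pr (fun x => (n : ℝ) * f x) P) (hf : IsBoundedDensity f) :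
    ∀ᵐ ω ∂Pr, (P ω).Finite := by
  have := hf.isProbabilityMeasure
  have h := hP.lintegral_encard hf MeasurableSet.univ
  have h2 := ae_lt_top (measurable_encard_toENNReal hP.measurable MeasurableSet.univ)
    (by rw [h]; exact ENNReal.mul_ne_top (ENNReal.natCast_ne_top n) (measure_ne_top _ _))
  filter_upwards [h2] with ω hω
  rw [Set.inter_univ, ENat.toENNReal_lt_top] at hω
  exact Set.encard_lt_top_iff.1 hω

lemma integral_range_eq_measureReal {p : ℕ} {φ : Set (EuclideanSpace ℝ (Fin d)) → ℝ}
    (hφ : ∀ Y, φ Y = 0 ∨ φ Y = 1)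
    (hm : Measurable fun x : Fin p → EuclideanSpace ℝ (Fin d) => φ (Set.range x))
    (ν : Measure (Fin p → EuclideanSpace ℝ (Fin d))) :
    ∫ x, φ (Set.range x) ∂ν = ν.real {x | φ (Set.range x) = 1} := by
  have hS : MeasurableSet {x : Fin p → EuclideanSpace ℝ (Fin d) | φ (Set.range x) = 1} :=
    hm (measurableSet_singleton (1 : ℝ))
  rw [← integral_indicator_one hS]
  refine integral_congr_ae (ae_of_all _ fun x => ?_)
  rcases hφ (Set.range x) with h | h <;> simp [h]

/-- First moment of the number of `φ`-subsets of a Poisson process. -/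
lemma IsPoissonProcess.integrable_subsetCount_and_integral_eq [IsProbabilityMeasure Pr]
    {P : Ω → Set (EuclideanSpace ℝ (Fin d))} {n : ℕ}
    (hP : IsPoissonProcess Pr (fun x => (n : ℝ) * f x) P) (hf : IsBoundedDensity f)
    {p : ℕ} {φ : Set (EuclideanSpace ℝ (Fin d)) → ℝ}
    (hφ : ∀ Y, φ Y = 0 ∨ φ Y = 1) (hp : ∀ Y, Y.encard ≠ (p : ℕ∞) → φ Y = 0)
    (hm : Measurable fun x : Fin p → EuclideanSpace ℝ (Fin d) => φ (Set.range x)) :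
    Integrable (fun ω => subsetCount φ (P ω)) Pr ∧
      ∫ ω, subsetCount φ (P ω) ∂Pr = (n : ℝ) ^ p / p.factorial *
        ∫ x, φ (Set.range x) ∂(Measure.pi fun _ : Fin p =>
          (volume : Measure (EuclideanSpace ℝ (Fin d))).withDensity
            fun x => ENNReal.ofReal (f x)) := by
  classical
  have := hf.isProbabilityMeasure
  set μ := (volume : Measure (EuclideanSpace ℝ (Fin d))).withDensity
    fun x => ENNReal.ofReal (f x)
  -- `Q` changes `P` on a null set so as to be finite for every `ω`. Means and independence of the
  -- counts transfer because they agree almost surely.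
  set Q : Ω → Set (EuclideanSpace ℝ (Fin d)) := fun ω => if (P ω).Finite then P ω else ∅
  have hQfin : ∀ ω, (Q ω).Finite := fun ω => by
    by_cases h : (P ω).Finite <;> simp [Q, h]
  have hQP : ∀ᵐ ω ∂Pr, Q ω = P ω := by
    filter_upwards [hP.ae_finite hf] with ω h
    simp [Q, h]
  have hfm : MeasurableSet {ω | (P ω).Finite} := by
    have : {ω | (P ω).Finite} = (fun ω => (P ω ∩ Set.univ).encard) ⁻¹' {⊤}ᶜ := by
      ext ω; simp
    rw [this]
    exact hP.measurable _ MeasurableSet.univ (measurableSet_singleton _).compl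
  have hQm : ∀ A, MeasurableSet A → Measurable fun ω => (Q ω ∩ A).encard := by
    intro A hA
    have : (fun ω => (Q ω ∩ A).encard) =
        fun ω => if (P ω).Finite then (P ω ∩ A).encard else 0 := by
      funext ω
      by_cases h : (P ω).Finite <;> simp [Q, h]
    rw [this]
    exact Measurable.ite hfm (hP.measurable A hA) measurable_const
  have hQcount : ∀ A, (fun ω => (P ω ∩ A).encard) =ᵐ[Pr] fun ω => (Q ω ∩ A).encard := by
    intro A
    filter_upwards [hQP] with ω h
    rw [h]
  set S : Set (Fin p → EuclideanSpace ℝ (Fin d)) := {x | φ (Set.range x) = 1}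
  have hS : MeasurableSet S := hm (measurableSet_singleton (1 : ℝ))
  obtain ⟨hmeas, hint⟩ := measurable_count_tuples_and_lintegral_eq (Pr := Pr) (P := Q) (μ := μ)
    (c := n) (p := p) hQfin hQm
    (fun A hA => by
      rw [← hP.lintegral_encard hf hA]
      refine lintegral_congr_ae ?_
      filter_upwards [hQP] with ω h
      rw [h])
    (ENNReal.natCast_ne_top n)
    (fun A hA hd => (hP.indep p A hA hd).congr fun i => hQcount (A i)) hS
    (fun x hx => injective_of_encard_range (by
      by_contra hne
      have hx' : φ (Set.range x) = 1 := hx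
      rw [hp _ hne] at hx'
      exact zero_ne_one hx'))
  have hne : ∫⁻ ω, Measure.count (S ∩ {x | ∀ i, x i ∈ Q ω}) ∂Pr ≠ ∞ := by
    rw [hint]
    exact ENNReal.mul_ne_top (ENNReal.pow_ne_top (ENNReal.natCast_ne_top n)) (measure_ne_top _ _)
  have hfac : (p.factorial : ℝ) ≠ 0 := Nat.cast_ne_zero.2 p.factorial_ne_zero
  have heq : (fun ω => subsetCount φ (P ω)) =ᵐ[Pr] fun ω =>
      (p.factorial : ℝ)⁻¹ * (Measure.count (S ∩ {x | ∀ i, x i ∈ Q ω})).toReal := by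
    filter_upwards [hQP] with ω h
    rw [eq_inv_mul_iff_mul_eq₀ hfac, ← h, factorial_mul_subsetCount hφ hp (hQfin ω)]
    have hset : {x : Fin p → EuclideanSpace ℝ (Fin d) |
        (∀ i, x i ∈ Q ω) ∧ φ (Set.range x) = 1} = S ∩ {x | ∀ i, x i ∈ Q ω} := by
      ext x; exact and_comm
    have hfin : (S ∩ {x | ∀ i, x i ∈ Q ω}).Finite :=
      (Set.Finite.pi fun _ : Fin p => hQfin ω).subset fun x hx i _ => hx.2 i
    rw [hset, Measure.count_apply_finite _ hfin, Set.ncard_eq_toFinset_card _ hfin,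
      ENNReal.toReal_natCast]
  refine ⟨((integrable_toReal_of_lintegral_ne_top hmeas.aemeasurable hne).const_mul _).congr
    heq.symm, ?_⟩
  rw [integral_congr_ae heq, integral_const_mul,
    integral_toReal hmeas.aemeasurable (ae_lt_top hmeas hne), hint, ENNReal.toReal_mul,
    integral_range_eq_measureReal hφ hm, measureReal_def]
  simp only [ENNReal.toReal_pow, ENNReal.toReal_natCast]
  ring

/-- For `d ≠ 0` the law has no atoms, so by Fubini the diagonal is null for each pair of indices,
and there are countably many pairs. -/
lemma IsIIDSample.ae_injective (hd : d ≠ 0) [IsProbabilityMeasure Pr]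
    {X : ℕ → Ω → EuclideanSpace ℝ (Fin d)} (hX : IsIIDSample Pr f X) (hf : IsBoundedDensity f) :
    ∀ᵐ ω ∂Pr, Function.Injective fun i => X i ω := by
  have := hf.isProbabilityMeasure
  have : Nonempty (Fin d) := ⟨⟨0, Nat.pos_of_ne_zero hd⟩⟩
  have : NullSingletonClass ((volume : Measure (EuclideanSpace ℝ (Fin d))).withDensity
    fun x => ENNReal.ofReal (f x)) := nullSingletonClass_withDensity _
  have h : ∀ i j, i ≠ j → ∀ᵐ ω ∂Pr, X i ω ≠ X j ω := by
    intro i j hij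
    have hmap := (indepFun_iff_map_prod_eq_prod_map_map (hX.measurable i).aemeasurable
      (hX.measurable j).aemeasurable).1 (hX.indep.indepFun hij)
    have hdiag : Pr.map (fun ω => (X i ω, X j ω))
        (Set.diagonal (EuclideanSpace ℝ (Fin d))) = 0 := by
      rw [hmap, hX.law, hX.law, Measure.measure_prod_null measurableSet_diagonal]
      refine ae_of_all _ fun x => ?_
      have : Prod.mk x ⁻¹' Set.diagonal (EuclideanSpace ℝ (Fin d)) = {x} := by
        ext y; simp [eq_comm]
      simp only [this, Pi.zero_apply]
      exact measure_singleton x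
    rw [Measure.map_apply ((hX.measurable i).prodMk (hX.measurable j))
      measurableSet_diagonal] at hdiag
    exact measure_eq_zero_iff_ae_notMem.1 hdiag
  have h' : ∀ᵐ ω ∂Pr, ∀ i j, i ≠ j → X i ω ≠ X j ω :=
    ae_all_iff.2 fun i => ae_all_iff.2 fun j => by
      by_cases hij : i = j
      · exact ae_of_all _ fun ω h => absurd hij h
      · filter_upwards [h i j hij] with ω hω _ using hω
  filter_upwards [h'] with ω hω i j hij
  by_contra hne
  exact hω i j hne hij

/-- First moment of the number of `φ`-subsets of a binomial process. -/
lemma IsIIDSample.integrable_subsetCount_and_integral_eq (hd : d ≠ 0) [IsProbabilityMeasure Pr]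
    {X : ℕ → Ω → EuclideanSpace ℝ (Fin d)} (hX : IsIIDSample Pr f X) (hf : IsBoundedDensity f)
    (n : ℕ) {p : ℕ} {φ : Set (EuclideanSpace ℝ (Fin d)) → ℝ}
    (hφ : ∀ Y, φ Y = 0 ∨ φ Y = 1) (hp : ∀ Y, Y.encard ≠ (p : ℕ∞) → φ Y = 0)
    (hm : Measurable fun x : Fin p → EuclideanSpace ℝ (Fin d) => φ (Set.range x)) :
    Integrable (fun ω => subsetCount φ (binomialProcess X n ω)) Pr ∧
      ∫ ω, subsetCount φ (binomialProcess X n ω) ∂Pr =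
        (n.descFactorial p : ℝ) / p.factorial *
        ∫ x, φ (Set.range x) ∂(Measure.pi fun _ : Fin p =>
          (volume : Measure (EuclideanSpace ℝ (Fin d))).withDensity
            fun x => ENNReal.ofReal (f x)) := by
  have := hf.isProbabilityMeasure
  have hfac : (p.factorial : ℝ) ≠ 0 := Nat.cast_ne_zero.2 p.factorial_ne_zero
  have heq : (fun ω => subsetCount φ (binomialProcess X n ω)) =ᵐ[Pr] fun ω =>
      (p.factorial : ℝ)⁻¹ *
        ∑ σ : Fin p ↪ Fin n, φ (Set.range fun i => X (σ i) ω) := by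
    filter_upwards [hX.ae_injective hd hf] with ω h
    have hset : binomialProcess X n ω = Set.range fun i : Fin n => X i ω := by
      ext x
      simp only [binomialProcess, Set.mem_image, Set.mem_ofPred_eq, Set.mem_range]
      exact ⟨fun ⟨i, hi, hx⟩ => ⟨⟨i, hi⟩, hx⟩, fun ⟨i, hx⟩ => ⟨i, i.2, hx⟩⟩
    rw [eq_inv_mul_iff_mul_eq₀ hfac, hset,
      factorial_mul_subsetCount_range hφ hp fun i j hij => Fin.ext (h hij)]
  have hXm : ∀ σ : Fin p ↪ Fin n, Measurable fun ω (i : Fin p) => X (σ i) ω := fun σ =>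
    measurable_pi_lambda _ fun i => hX.measurable _
  have hlaw : ∀ σ : Fin p ↪ Fin n, Pr.map (fun ω (i : Fin p) => X (σ i) ω) =
      Measure.pi fun _ : Fin p => (volume : Measure (EuclideanSpace ℝ (Fin d))).withDensity
        fun x => ENNReal.ofReal (f x) := by
    intro σ
    have hi : iIndepFun (fun i : Fin p => X (σ i)) Pr :=
      hX.indep.precomp (g := fun i : Fin p => ((σ i : Fin n) : ℕ))
        fun i j hij => σ.injective (Fin.ext hij)
    rw [(iIndepFun_iff_map_fun_eq_pi_map fun i => (hX.measurable _).aemeasurable).1 hi]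
    simp_rw [hX.law]
  have hint : ∀ σ : Fin p ↪ Fin n,
      Integrable (fun ω => φ (Set.range fun i => X (σ i) ω)) Pr := by
    intro σ
    refine Integrable.of_bound (hm.comp (hXm σ)).aestronglyMeasurable 1 (ae_of_all _ fun ω => ?_)
    rcases hφ (Set.range fun i => X (σ i) ω) with h | h <;> simp [h]
  refine ⟨((integrable_finsetSum _ fun σ _ => hint σ).const_mul _).congr heq.symm, ?_⟩
  rw [integral_congr_ae heq, integral_const_mul, integral_finsetSum _ fun σ _ => hint σ]
  have hval : ∀ σ : Fin p ↪ Fin n, ∫ ω, φ (Set.range fun i => X (σ i) ω) ∂Pr =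
      ∫ x, φ (Set.range x) ∂(Measure.pi fun _ : Fin p =>
          (volume : Measure (EuclideanSpace ℝ (Fin d))).withDensity
            fun x => ENNReal.ofReal (f x)) := by
    intro σ
    rw [← hlaw σ, integral_map (hXm σ).aemeasurable hm.aestronglyMeasurable]
  simp_rw [hval]
  -- All embeddings contribute equally, and there are `n.descFactorial p` of them, which is zero
  -- when `n < p`.
  rw [Finset.sum_const, Finset.card_univ, Fintype.card_embedding_eq, Fintype.card_fin,
    Fintype.card_fin, nsmul_eq_mul]
  ring

end

/-! ### Consequences of invariance and locality. -/

namespace IsFiniteGeometricProperty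

variable {d : ℕ} {g : ℝ → ℕ → Set (EuclideanSpace ℝ (Fin d)) → ℝ}

lemma apply_insert_rescaled (hg : IsFiniteGeometricProperty g) {r : ℝ} (hr : 0 < r) (p : ℕ)
    {q : ℕ} (a : EuclideanSpace ℝ (Fin d)) (y : Fin q → EuclideanSpace ℝ (Fin d)) :
    g r p (insert a (Set.range fun i => a + r • y i)) = g 1 p (insert 0 (Set.range y)) := by
  rw [hg.scaling 1 p _ r one_pos hr, mul_one,
    hg.translation r p ((fun z => r • z) '' insert 0 (Set.range y)) a hr]
  congr 1
  simp only [Set.image_insert_eq, smul_zero, zero_add, ← Set.range_comp]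
  congr 2
  funext i
  simp [add_comm]

lemma measurable_insert_zero {q : ℕ}
    (hgm : Measurable (fun x : Fin (q + 1) → EuclideanSpace ℝ (Fin d) =>
      g 1 (q + 1) (Set.range x))) :
    Measurable (fun y : Fin q → EuclideanSpace ℝ (Fin d) =>
      g 1 (q + 1) (insert 0 (Set.range y))) := by
  have h : Measurable fun y : Fin q → EuclideanSpace ℝ (Fin d) =>
      (Fin.cons 0 y : Fin (q + 1) → EuclideanSpace ℝ (Fin d)) :=
    measurable_pi_lambda _ fun i => by
      refine Fin.cases ?_ (fun j => ?_) i
      · simp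
      · simpa using measurable_pi_apply j
  have := hgm.comp h
  simpa [Function.comp_def, Fin.range_cons] using this

/-- Locality confines every `y i` to a fixed ball around the point `0` of the configuration, so the
function is a bounded one with bounded support. -/
lemma integrable_insert_zero (hg : IsFiniteGeometricProperty g) {q : ℕ}
    (hgm : Measurable (fun x : Fin (q + 1) → EuclideanSpace ℝ (Fin d) =>
      g 1 (q + 1) (Set.range x))) :
    Integrable (fun y : Fin q → EuclideanSpace ℝ (Fin d) =>
      g 1 (q + 1) (insert 0 (Set.range y))) := by
  obtain ⟨C, hC⟩ := hg.isLocal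
  -- The constant `C` may be negative, while the sup-distance criterion requires a nonnegative
  -- radius.
  set R : ℝ := max (C * 1 * ((q + 1 : ℕ) : ℝ)) 0
  have hball : Integrable ((Metric.closedBall (0 : Fin q → EuclideanSpace ℝ (Fin d)) R).indicator
      fun _ => (1 : ℝ)) :=
    (integrable_indicator_iff measurableSet_closedBall).2
      (integrableOn_const measure_closedBall_lt_top.ne)
  refine hball.mono' (measurable_insert_zero hgm).aestronglyMeasurable (ae_of_all _ fun y => ?_)
  rcases hg.indicator 1 (q + 1) (insert 0 (Set.range y)) one_pos with h | h
  · rw [h, norm_zero]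
    exact Set.indicator_nonneg (fun _ _ => zero_le_one) _
  · have hy : y ∈ Metric.closedBall (0 : Fin q → EuclideanSpace ℝ (Fin d)) R := by
      rw [Metric.mem_closedBall, dist_pi_le_iff (le_max_right _ _)]
      intro i
      refine le_trans ?_ ((hC 1 (q + 1) _ one_pos h).trans (le_max_left _ _))
      exact Metric.dist_le_diam_of_mem ((Set.finite_range y).insert 0).isBounded
        (Set.mem_insert_of_mem _ ⟨i, rfl⟩) (Set.mem_insert _ _)
    rw [h, Set.indicator_of_mem hy, norm_one]

/-- The probability of the property, after the substitution `x_{i+1} = x_0 + r y_i`. -/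
lemma integral_pi_eq_rescaled (hg : IsFiniteGeometricProperty g)
    {f : EuclideanSpace ℝ (Fin d) → ℝ} (hf : IsBoundedDensity f) {q : ℕ} {r : ℝ} (hr : 0 < r)
    (hgm : Measurable (fun x : Fin (q + 1) → EuclideanSpace ℝ (Fin d) =>
      g r (q + 1) (Set.range x))) :
    ∫ x, g r (q + 1) (Set.range x) ∂(Measure.pi fun _ : Fin (q + 1) =>
        (volume : Measure (EuclideanSpace ℝ (Fin d))).withDensity
          fun x => ENNReal.ofReal (f x)) =
      (r ^ d) ^ q * ∫ x, ∫ y : Fin q → EuclideanSpace ℝ (Fin d),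
        f x * (∏ i, f (x + r • y i)) * g 1 (q + 1) (insert 0 (Set.range y)) := by
  have := hf.isProbabilityMeasure
  have hprod0 : ∀ x : Fin (q + 1) → EuclideanSpace ℝ (Fin d), 0 ≤ ∏ i, f (x i) := fun x =>
    Finset.prod_nonneg fun i _ => hf.nonneg _
  have hprodm : Measurable fun x : Fin (q + 1) → EuclideanSpace ℝ (Fin d) => ∏ i, f (x i) :=
    Finset.measurable_prod _ fun i _ => hf.measurable.comp (measurable_pi_apply i)
  rw [pi_withDensity_ofReal hf.integrable hf.nonneg,
    integral_withDensity_eq_integral_toReal_smul hprodm.ennreal_ofReal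
      (ae_of_all _ fun x => ENNReal.ofReal_lt_top)]
  simp_rw [fun x => ENNReal.toReal_ofReal (hprod0 x), smul_eq_mul]
  have hint : Integrable fun x : Fin (q + 1) → EuclideanSpace ℝ (Fin d) =>
      (∏ i, f (x i)) * g r (q + 1) (Set.range x) := by
    refine (Integrable.fintype_prod fun _ => hf.integrable).mul_bdd (c := 1)
      hgm.aestronglyMeasurable (ae_of_all _ fun x => ?_)
    rcases hg.indicator r (q + 1) (Set.range x) hr with h | h <;> simp [h]
  have hmp := (volume_preserving_piFinSuccAbove
    (fun _ : Fin (q + 1) => EuclideanSpace ℝ (Fin d)) 0).symm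
  have hint2 := (hmp.integrable_comp_emb (MeasurableEquiv.measurableEmbedding _)).2 hint
  rw [← hmp.integral_comp' (fun x : Fin (q + 1) → EuclideanSpace ℝ (Fin d) =>
    (∏ i, f (x i)) * g r (q + 1) (Set.range x))]
  refine (integral_prod _ hint2).trans ?_
  rw [← integral_const_mul]
  refine integral_congr_ae (ae_of_all _ fun a => ?_)
  simp only [Function.comp_apply, MeasurableEquiv.piFinSuccAbove_symm_apply, Fin.insertNthEquiv, Fin.insertNth_zero,
    Equiv.coe_fn_mk, Fin.prod_univ_succ, Fin.cons_zero, Fin.cons_succ, Fin.range_cons, cast_eq]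
  -- After splitting off the coordinate `a`, the others are translated by `a` and then scaled by
  -- `r`; the Jacobian on `(ℝ^d)^q` is `r^(d q)`.
  rw [← integral_add_left_eq_self _ (fun _ : Fin q => a)]
  have hsc := Measure.integral_comp_smul_of_nonneg
    (volume : Measure (Fin q → EuclideanSpace ℝ (Fin d)))
    (fun z : Fin q → EuclideanSpace ℝ (Fin d) =>
      f a * (∏ i, f (a + z i)) *
        g r (q + 1) (insert a (Set.range fun i => a + z i))) r (hR := hr.le)
  have hrank : Module.finrank ℝ (Fin q → EuclideanSpace ℝ (Fin d)) = d * q := by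
    rw [Module.finrank_pi_fintype]
    simp [mul_comm]
  rw [hrank, smul_eq_mul, pow_mul, eq_inv_mul_iff_mul_eq₀ (by positivity)] at hsc
  refine hsc.symm.trans ?_
  congr 1
  refine integral_congr_ae (ae_of_all _ fun y => ?_)
  simp only [Pi.smul_apply]
  rw [← hg.apply_insert_rescaled hr (q + 1) a y]

end IsFiniteGeometricProperty

/-! ### The limit theorem. -/

lemma tendsto_descFactorial_div_pow (p : ℕ) :
    Tendsto (fun n : ℕ => (n.descFactorial p : ℝ) / (n : ℝ) ^ p) atTop (𝓝 1) := by
  induction p with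
  | zero => simp
  | succ p ih =>
    have h : Tendsto (fun n : ℕ => ((n - p : ℕ) : ℝ) / n) atTop (𝓝 1) := by
      have h0 : Tendsto (fun n : ℕ => 1 - (p : ℝ) / n) atTop (𝓝 1) := by
        simpa using (tendsto_const_div_atTop_nhds_zero_nat (p : ℝ)).const_sub 1
      refine h0.congr' ?_
      filter_upwards [eventually_ge_atTop p, eventually_gt_atTop 0] with n hn hn0
      have : (n : ℝ) ≠ 0 := Nat.cast_ne_zero.2 hn0.ne'
      rw [Nat.cast_sub hn, sub_div, div_self this]
    refine (by simpa using h.mul ih : Tendsto _ _ (𝓝 (1 : ℝ))).congr fun n => ?_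
    rw [Nat.descFactorial_succ, Nat.cast_mul, pow_succ', mul_div_mul_comm]

theorem mainTheorem3 {d : ℕ}
    {Ω : Type*} [MeasurableSpace Ω] (Pr : Measure Ω) [IsProbabilityMeasure Pr]
    (f : EuclideanSpace ℝ (Fin d) → ℝ) (hf : IsBoundedDensity f)
    (X : ℕ → Ω → EuclideanSpace ℝ (Fin d)) (hX : IsIIDSample Pr f X)
    (P : ℕ → Ω → Set (EuclideanSpace ℝ (Fin d)))
    (hP : ∀ n : ℕ, IsPoissonProcess Pr (fun x => (n : ℝ) * f x) (P n))
    (g : ℝ → ℕ → Set (EuclideanSpace ℝ (Fin d)) → ℝ) (hg : IsFiniteGeometricProperty g)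
    (p : ℕ) (hp : 2 ≤ p)
    (hgm : ∀ r : ℝ, 0 < r →
      Measurable (fun x : Fin p → EuclideanSpace ℝ (Fin d) => g r p (Set.range x)))
    (hpos : ∀ᶠ r in 𝓝[>] (0 : ℝ), 0 < Pr {ω | g r p (binomialProcess X p ω) = 1})
    (r : ℕ → ℝ) (hr : ∀ n, 0 < r n) (hr0 : Tendsto r atTop (𝓝 0)) :
    (Integrable (fun x => f x ^ p) volume ∧
      Integrable (fun y : Fin (p - 1) → EuclideanSpace ℝ (Fin d) =>
        g 1 p (insert 0 (Set.range y))) volume) ∧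
    ((∀ n, Integrable (fun ω => subsetCount (g (r n) p) (binomialProcess X n ω)) Pr) ∧
      Tendsto (fun n : ℕ =>
          (∫ ω, subsetCount (g (r n) p) (binomialProcess X n ω) ∂Pr) /
            ((n : ℝ) * (r n ^ d * (n : ℝ)) ^ (p - 1)))
        atTop (𝓝 (limitConstant f p (g 1 p)))) ∧
    ((∀ n, Integrable (fun ω => subsetCount (g (r n) p) (P n ω)) Pr) ∧
      Tendsto (fun n : ℕ =>
          (∫ ω, subsetCount (g (r n) p) (P n ω) ∂Pr) /
            ((n : ℝ) * (r n ^ d * (n : ℝ)) ^ (p - 1)))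
        atTop (𝓝 (limitConstant f p (g 1 p)))) := by

  -- If `d = 0` the space is a single point, so no sample contains `p ≥ 2` distinct points and the
  -- property has probability zero, against `hpos`.
  have hd : d ≠ 0 := by
    rintro rfl
    obtain ⟨s, hs, hs0⟩ := (hpos.and self_mem_nhdsWithin).exists
    obtain ⟨ω, hω⟩ := nonempty_of_measure_ne_zero hs.ne'
    have hω' : g s p (binomialProcess X p ω) = 1 := hω
    have hne : (binomialProcess X p ω).encard ≠ (p : ℕ∞) := by
      intro h
      have h1 : (binomialProcess X p ω).encard ≤ 1 :=
        Set.encard_le_one_iff.2 fun a b _ _ => Subsingleton.elim a b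
      rw [h] at h1
      have : p ≤ 1 := by exact_mod_cast h1
      omega
    rw [hg.finite s p _ hs0 hne] at hω'
    exact zero_ne_one hω'
  obtain ⟨q, rfl⟩ : ∃ q, p = q + 1 := ⟨p - 1, by omega⟩
  have hφ : Integrable (fun y : Fin q → EuclideanSpace ℝ (Fin d) =>
    g 1 (q + 1) (insert 0 (Set.range y))) := hg.integrable_insert_zero (hgm 1 one_pos)
  have hbin := fun n => hX.integrable_subsetCount_and_integral_eq hd hf n (φ := g (r n) (q + 1))
    (fun Y => hg.indicator _ _ Y (hr n)) (fun Y => hg.finite _ _ Y (hr n)) (hgm _ (hr n))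
  have hpoi := fun n => (hP n).integrable_subsetCount_and_integral_eq hf (φ := g (r n) (q + 1))
    (fun Y => hg.indicator _ _ Y (hr n)) (fun Y => hg.finite _ _ Y (hr n)) (hgm _ (hr n))
  have hlim : Tendsto (fun n => ((q + 1).factorial : ℝ)⁻¹ * ∫ x, ∫ y : Fin q →
      EuclideanSpace ℝ (Fin d), f x * (∏ i, f (x + r n • y i)) *
        g 1 (q + 1) (insert 0 (Set.range y))) atTop
      (𝓝 (limitConstant f (q + 1) (g 1 (q + 1)))) := by
    have h := (hf.tendsto_integral_integral_rescaled hφ hr0).const_mul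
      (((q + 1).factorial : ℝ)⁻¹)
    rw [← mul_assoc] at h
    rw [limitConstant, one_div]
    exact h
  refine ⟨⟨hf.integrable_pow (Nat.succ_ne_zero q), hφ⟩, ⟨fun n => (hbin n).1, ?_⟩,
    ⟨fun n => (hpoi n).1, ?_⟩⟩
  -- For `n > 0` the normalised expectation is the falling-factorial ratio times the sequence in
  -- `hlim`, as `n (r^d n)^q = n^(q+1) (r^d)^q`. In the Poisson case the ratio is exactly 1.
  · have h := (tendsto_descFactorial_div_pow (q + 1)).mul hlim
    rw [one_mul] at h
    refine h.congr' ?_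
    filter_upwards [eventually_gt_atTop 0] with n hn
    have hn' : (n : ℝ) ≠ 0 := Nat.cast_ne_zero.2 hn.ne'
    have hrn := (hr n).ne'
    rw [(hbin n).2, hg.integral_pi_eq_rescaled hf (hr n) (hgm _ (hr n)), Nat.add_sub_cancel]
    field_simp
    ring
  · refine hlim.congr' ?_
    filter_upwards [eventually_gt_atTop 0] with n hn
    have hn' : (n : ℝ) ≠ 0 := Nat.cast_ne_zero.2 hn.ne'
    have hrn := (hr n).ne'
    rw [(hpoi n).2, hg.integral_pi_eq_rescaled hf (hr n) (hgm _ (hr n)), Nat.add_sub_cancel]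
    field_simp
    ring
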